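/- Let $\mathcal S$ be the unit sphere in $\mathbb R^3$, let $d\in\mathcal S$ be a fixed (non-random) unit vector, and let $o_{\mathrm{Tx}},o_{\mathrm{Rx}}$ be independent random vectors, each uniformly distributed on $\mathcal S$. Define the scaled near field and the scaled far field $$b_{\mathrm{nf}}=\tfrac12\,(3dd^{\mathsf T}-I_3)\,o_{\mathrm{Tx}},\qquad b_{\mathrm{ff}}=(I_3-dd^{\mathsf T})\,o_{\mathrm{Tx}},$$ their magnitudes $\beta_{\mathrm{nf}}=\|b_{\mathrm{nf}}\|$ and $\beta_{\mathrm{ff}}=\|b_{\mathrm{ff}}\|$ (Euclidean norm), and the alignment factors $J_{\mathrm{nf}}=o_{\mathrm{Rx}}^{\mathsf T}b_{\mathrm{nf}}$ and $J_{\mathrm{ff}}=o_{\mathrm{Rx}}^{\mathsf T}b_{\mathrm{ff}}$. Then each of $J_{\mathrm{nf}},J_{\mathrm{ff}},\beta_{\mathrm{nf}},\beta_{\mathrm{ff}}$ has a probability density function with respect to Lebesgue measure on $\mathbb R$, namely (up to null sets): 1. with $\bar\beta_{\mathrm{nf}}=\dfrac{\sqrt3}{2\,\mathrm{arcosh}(2)}$,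 $$f_{J_{\mathrm{nf}}}(x)=\frac1{2\bar\beta_{\mathrm{nf}}}\cdot\begin{cases}1,&|x|\le\frac12,\\[2pt] 1-\dfrac{\mathrm{arcosh}(2|x|)}{\mathrm{arcosh}(2)},&\frac12<|x|<1,\\[2pt] 0,&1\le|x|;\end{cases}$$ 2. $f_{J_{\mathrm{ff}}}(x)=\frac12\left(\frac\pi2-\arcsin|x|\right)$ for $-1\le x\le1$, and $f_{J_{\mathrm{ff}}}(x)=0$ otherwise; 3. $f_{\beta_{\mathrm{nf}}}(x)=\dfrac4{\sqrt3}\,\dfrac{x}{\sqrt{4x^2-1}}$ for $\frac12<x\le1$, and $f_{\beta_{\mathrm{nf}}}(x)=0$ otherwise; 4. $f_{\beta_{\mathrm{ff}}}(x)=\dfrac{x}{\sqrt{1-x^2}}$ for $0\le x<1$, and $f_{\beta_{\mathrm{ff}}}(x)=0$ otherwise. -/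

import Mathlib

open MeasureTheory ProbabilityTheory

namespace DipoleChannel

noncomputable section

/-- Euclidean three-space. -/
abbrev E3 : Type := EuclideanSpace ℝ (Fin 3)

/-- The unit sphere of Euclidean three-space. -/
abbrev S2 : Type := Metric.sphere (0 : E3) 1

/-- The uniform probability distribution on the unit sphere: surface measure, normalized by
the total surface area. -/
def uniformSphere : Measure S2 :=
  ((volume : Measure E3).toSphere Set.univ)⁻¹ • (volume : Measure E3).toSphere

/-- The rank-one matrix `d dᵀ`. -/
def outer (d : S2) : Matrix (Fin 3) (Fin 3) ℝ :=
  Matrix.vecMulVec (fun i => (d : E3) i) (fun i => (d : E3) i)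

/-- The scaled near field `b_nf = (1/2) (3 d dᵀ - I) o` of a transmitting dipole with
orientation `o`, in direction `d`. -/
def bNear (d o : S2) : E3 :=
  Matrix.toEuclideanLin ((1 / 2 : ℝ) • ((3 : ℝ) • outer d - 1)) (o : E3)

/-- The scaled far field `b_ff = (I - d dᵀ) o`. -/
def bFar (d o : S2) : E3 :=
  Matrix.toEuclideanLin (1 - outer d) (o : E3)

/-- The near-field magnitude `β_nf = ‖b_nf‖`. -/
def betaNear (d oTx : S2) : ℝ := ‖bNear d oTx‖

/-- The far-field magnitude `β_ff = ‖b_ff‖`. -/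
def betaFar (d oTx : S2) : ℝ := ‖bFar d oTx‖

/-- The near-field alignment factor `J_nf = o_Rxᵀ b_nf`. -/
def JNear (d oTx oRx : S2) : ℝ := inner ℝ (oRx : E3) (bNear d oTx)

/-- The far-field alignment factor `J_ff = o_Rxᵀ b_ff`. -/
def JFar (d oTx oRx : S2) : ℝ := inner ℝ (oRx : E3) (bFar d oTx)

/-- The constant `√3 / (2 arcosh 2)`. -/
def betaBar : ℝ := Real.sqrt 3 / (2 * Real.arcosh 2)

/-- The claimed density of `J_nf`. -/
def pdfJNear (x : ℝ) : ℝ :=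
  1 / (2 * betaBar) *
    (if |x| ≤ 1 / 2 then 1
     else if |x| < 1 then 1 - Real.arcosh (2 * |x|) / Real.arcosh 2
     else 0)

/-- The claimed density of `J_ff`. -/
def pdfJFar (x : ℝ) : ℝ :=
  (Set.Icc (-1 : ℝ) 1).indicator (fun y => 1 / 2 * (Real.pi / 2 - Real.arcsin |y|)) x

/-- The claimed density of `β_nf`. -/
def pdfBetaNear (x : ℝ) : ℝ :=
  (Set.Icc (1 / 2 : ℝ) 1).indicator
    (fun y => 4 / Real.sqrt 3 * (y / Real.sqrt (4 * y ^ 2 - 1))) x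

/-- The claimed density of `β_ff`. -/
def pdfBetaFar (x : ℝ) : ℝ :=
  (Set.Icc (0 : ℝ) 1).indicator (fun y => y / Real.sqrt (1 - y ^ 2)) x

/-- The real random variable `X` on `(Ω, P)` has the probability density function `f` with
respect to Lebesgue measure: `f` is measurable and nonnegative, `X` is a random variable, and
its law is the measure with density `f`. -/
structure HasDensity {Ω : Type*} [MeasurableSpace Ω] (X : Ω → ℝ) (f : ℝ → ℝ)
    (P : Measure Ω) : Prop where
  measurable : Measurable f
  nonneg : ∀ x, 0 ≤ f x
  hasLaw : HasLaw X (volume.withDensity fun x => ENNReal.ofReal (f x)) P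

end

end DipoleChannel

/-! Everything reduces to `t = ⟨d, oTx⟩`. Since `d dᵀ` is the projection onto `d`, expanding the
norms gives `β_nf = √((1 + 3t²)/4)` and `β_ff = √(1 - t²)`. By Archimedes' theorem
(`map_inner_uniformSphere`) `t` is uniform on `(-1, 1)`, so a one-variable substitution
(`hasDensity_comp_of_uniform`) yields both magnitude densities.

For the alignment factors, fix `oTx`: by Archimedes again, `⟨oRx, b⟩` is `‖b‖` times a uniform
variable on `(-1, 1)`. Mixing over the length gives `J` the density `x ↦ ∫_{y > |x|} f_β(y) / (2y)
dy` (`hasDensity_inner`). The factor `y` in `f_β` cancels, leaving integrands with antiderivatives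
`arcosh(2y)/√3` and `arcsin(y)/2`. -/

namespace DipoleChannel
open Set ENNReal
open scoped Pointwise

/-! ### Archimedes' theorem on the sphere -/

/-- Integration of a radial function over the plane, in the variable `r²`. -/
theorem lintegral_plane_normSq (h : ℝ → ℝ≥0∞) (hh : Measurable h) :
    ∫⁻ p : ℝ × ℝ, h (p.1 ^ 2 + p.2 ^ 2) = ENNReal.ofReal Real.pi * ∫⁻ s in Ioi 0, h s := by
  have himage : (fun r : ℝ => r ^ 2) '' Ioi 0 = Ioi 0 := by
    ext s
    constructor
    · rintro ⟨r, hr, rfl⟩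
      exact pow_pos (mem_Ioi.1 hr) 2
    · intro hs
      exact ⟨√s, Real.sqrt_pos.2 hs, Real.sq_sqrt (le_of_lt hs)⟩
  have hsub : ∫⁻ s in Ioi 0, h s = ∫⁻ r in Ioi (0 : ℝ), ENNReal.ofReal |2 * r| * h (r ^ 2) := by
    conv_lhs => rw [← himage]
    refine lintegral_image_eq_lintegral_abs_deriv_mul measurableSet_Ioi
      (f' := fun r => 2 * r) (fun r _ => ?_) ?_ h
    · simpa using (hasDerivAt_pow 2 r).hasDerivWithinAt
    · intro a ha b hb hab
      exact (pow_left_inj₀ (le_of_lt ha) (le_of_lt hb) two_ne_zero).1 hab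
  rw [← lintegral_comp_polarCoord_symm, hsub, polarCoord_target, Measure.volume_eq_prod,
    ← Measure.prod_restrict, lintegral_prod _ (by
      simp only [polarCoord_symm_apply]
      fun_prop), ← lintegral_const_mul _ (by fun_prop)]
  refine setLIntegral_congr_fun measurableSet_Ioi fun r hr => ?_
  have hr' : (0 : ℝ) < r := hr
  have hsq (θ : ℝ) : (r * Real.cos θ) ^ 2 + (r * Real.sin θ) ^ 2 = r ^ 2 := by
    linear_combination r ^ 2 * Real.cos_sq_add_sin_sq θ
  simp only [polarCoord_symm_apply, hsq, lintegral_const, Measure.restrict_apply_univ,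
    Real.volume_Ioo, smul_eq_mul]
  rw [← mul_assoc, ← ENNReal.ofReal_mul Real.pi_pos.le, abs_of_pos (by positivity),
    mul_right_comm, ← ENNReal.ofReal_mul hr'.le]
  congr 2
  ring

theorem lintegral_comp_mul_left {a : ℝ} (ha : 0 < a) (f : ℝ → ℝ≥0∞) (hf : Measurable f) :
    ENNReal.ofReal a * ∫⁻ u, f (a * u) = ∫⁻ z, f z := by
  conv_rhs => rw [← Real.smul_map_volume_mul_left ha.ne']
  rw [lintegral_smul_measure, lintegral_map hf (by fun_prop), abs_of_pos ha, smul_eq_mul]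

/-- Integration over three-space of a function of one coordinate and of the norm. -/
theorem lintegral_inner_normSq (v : S2) (F : ℝ → ℝ → ℝ≥0∞)
    (hF : Measurable (Function.uncurry F)) :
    ∫⁻ x : E3, F (inner ℝ (v : E3) x) (‖x‖ ^ 2) =
      ENNReal.ofReal Real.pi * ∫⁻ z, ∫⁻ s in Ioi 0, F z (z ^ 2 + s) := by
  have hv : ‖(v : E3)‖ = 1 := mem_sphere_zero_iff_norm.1 v.2
  -- Complete `v` to an orthonormal basis with `v` at index `0`, making `⟨v, x⟩` a coordinate.
  obtain ⟨b, hb⟩ := Orthonormal.exists_orthonormalBasis_extension_of_card_eq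
    (𝕜 := ℝ) (E := E3) (ι := Fin 3) (by simp) (v := fun _ => (v : E3)) (s := {0}) (by
      constructor
      · intro i
        simp [hv]
      · intro i j hij
        exact (hij (Subsingleton.elim i j)).elim)
  have hb0 (x : E3) : inner ℝ (v : E3) x = b.repr x 0 := by
    rw [b.repr_apply_apply, hb 0 rfl]
  have hbn (x : E3) : ‖x‖ = ‖b.repr x‖ := (b.repr.norm_map x).symm
  have hFm : Measurable fun p : ℝ × ℝ => F p.1 p.2 := hF
  have e1 : ∫⁻ x : E3, F (inner ℝ (v : E3) x) (‖x‖ ^ 2) = ∫⁻ y : E3, F (y 0) (‖y‖ ^ 2) := by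
    rw [← b.measurePreserving_repr.lintegral_comp (f := fun y : E3 => F (y 0) (‖y‖ ^ 2))
      (hFm.comp (by fun_prop : Measurable fun y : E3 => (y 0, ‖y‖ ^ 2)))]
    exact lintegral_congr fun x => by rw [hb0, hbn]
  have e2 : ∫⁻ y : E3, F (y 0) (‖y‖ ^ 2) =
      ∫⁻ y : Fin 3 → ℝ, F (y 0) (y 0 ^ 2 + (y 1 ^ 2 + y 2 ^ 2)) := by
    rw [← (PiLp.volume_preserving_ofLp (Fin 3)).lintegral_comp
      (f := fun y : Fin 3 → ℝ => F (y 0) (y 0 ^ 2 + (y 1 ^ 2 + y 2 ^ 2)))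
      (hFm.comp (by fun_prop : Measurable fun y : Fin 3 → ℝ =>
        (y 0, y 0 ^ 2 + (y 1 ^ 2 + y 2 ^ 2))))]
    refine lintegral_congr fun y => ?_
    rw [EuclideanSpace.real_norm_sq_eq, Fin.sum_univ_three, add_assoc]
  have e3 : ∫⁻ y : Fin 3 → ℝ, F (y 0) (y 0 ^ 2 + (y 1 ^ 2 + y 2 ^ 2)) =
      ∫⁻ p : ℝ × (Fin 2 → ℝ), F p.1 (p.1 ^ 2 + (p.2 0 ^ 2 + p.2 1 ^ 2)) := by
    rw [← (volume_preserving_piFinSuccAbove (fun _ : Fin 3 => ℝ) 0).lintegral_comp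
      (f := fun p : ℝ × (Fin 2 → ℝ) => F p.1 (p.1 ^ 2 + (p.2 0 ^ 2 + p.2 1 ^ 2)))
      (hFm.comp (by fun_prop : Measurable fun p : ℝ × (Fin 2 → ℝ) =>
        (p.1, p.1 ^ 2 + (p.2 0 ^ 2 + p.2 1 ^ 2))))]
    rfl
  rw [e1, e2, e3, Measure.volume_eq_prod, lintegral_prod
      (fun p : ℝ × (Fin 2 → ℝ) => F p.1 (p.1 ^ 2 + (p.2 0 ^ 2 + p.2 1 ^ 2))) (hFm.comp
    (by fun_prop : Measurable fun p : ℝ × (Fin 2 → ℝ) =>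
        (p.1, p.1 ^ 2 + (p.2 0 ^ 2 + p.2 1 ^ 2)))).aemeasurable,
    ← lintegral_const_mul' _ _ ENNReal.ofReal_ne_top]
  refine lintegral_congr fun z => ?_
  have hz : Measurable fun s => F z (z ^ 2 + s) :=
    hFm.comp (by fun_prop : Measurable fun s => (z, z ^ 2 + s))
  rw [← lintegral_plane_normSq _ hz,
    ← (volume_preserving_piFinTwo fun _ : Fin 2 => ℝ).lintegral_comp
      (f := fun p : ℝ × ℝ => F z (z ^ 2 + (p.1 ^ 2 + p.2 ^ 2))) (hz.comp (by fun_prop : Measurable fun p : ℝ × ℝ => p.1 ^ 2 + p.2 ^ 2))]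
  rfl

/-- Put `ρ = z² + s`, swap the integrals, and scale `z = √ρ u`. The Jacobian `√ρ` does not involve
`u`; this is why a coordinate on the sphere in dimension three is uniform. -/
theorem lintegral_radial_slices (F : ℝ → ℝ → ℝ≥0∞) (hF : Measurable (Function.uncurry F)) :
    ∫⁻ z, ∫⁻ s in Ioi 0, F z (z ^ 2 + s) =
      ∫⁻ ρ in Ioi (0 : ℝ), ENNReal.ofReal √ρ * ∫⁻ u in Ioo (-1) 1, F (√ρ * u) ρ := by
  have hFm : Measurable fun p : ℝ × ℝ => F p.1 p.2 := hF
  set G : ℝ → ℝ → ℝ≥0∞ := fun z ρ => {p : ℝ × ℝ | p.1 ^ 2 < p.2}.indicator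
    (fun p => F p.1 p.2) (z, ρ) with hG
  have hGm : Measurable fun p : ℝ × ℝ => G p.1 p.2 :=
    hFm.indicator (measurableSet_lt (by fun_prop) (by fun_prop))
  have e1 (z : ℝ) : ∫⁻ s in Ioi 0, F z (z ^ 2 + s) = ∫⁻ ρ, G z ρ := by
    rw [← lintegral_indicator measurableSet_Ioi, ← lintegral_add_left_eq_self (G z) (z ^ 2)]
    refine lintegral_congr fun s => ?_
    simp [hG, indicator_apply]
  simp only [e1]
  rw [lintegral_lintegral_swap hGm.aemeasurable, ← lintegral_indicator measurableSet_Ioi]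
  refine lintegral_congr fun ρ => ?_
  rw [indicator_apply]
  split_ifs with hρ
  · have hs : 0 < √ρ := Real.sqrt_pos.2 hρ
    rw [← lintegral_comp_mul_left hs (fun z => G z ρ)
      (hGm.comp (by fun_prop : Measurable fun z : ℝ => (z, ρ))),
      ← lintegral_indicator measurableSet_Ioo]
    congr 1
    refine lintegral_congr fun u => ?_
    have : (√ρ * u) ^ 2 < ρ ↔ u ∈ Ioo (-1) 1 := by
      rw [mul_pow, Real.sq_sqrt (le_of_lt hρ), mul_lt_iff_lt_one_right hρ, sq_lt_one_iff_abs_lt_one,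
        abs_lt, mem_Ioo]
    simp only [hG, indicator_apply, mem_ofPred_eq, this]
  · rw [← lintegral_zero]
    refine lintegral_congr fun z => ?_
    simp only [hG, indicator_apply, mem_ofPred_eq]
    rw [if_neg]
    intro h
    exact hρ (lt_of_le_of_lt (sq_nonneg z) h)

/-- `toSphere` measures a set by the volume of the cone over it. Writing `√(‖x‖ ^ 2)` for the norm
puts the cone in the form needed by `lintegral_inner_normSq`. -/
theorem cone_preimage_inner (v : S2) (A : Set ℝ) :
    (Ioo (0 : ℝ) 1 • (Subtype.val '' ((fun o : S2 => inner ℝ (v : E3) (o : E3)) ⁻¹' A)) : Set E3) =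
      {x | 0 < ‖x‖ ^ 2 ∧ ‖x‖ ^ 2 < 1 ∧ inner ℝ (v : E3) x / √(‖x‖ ^ 2) ∈ A} := by
  ext x
  simp only [Set.mem_smul, mem_image, mem_preimage, mem_ofPred_eq, Real.sqrt_sq (norm_nonneg x)]
  constructor
  · rintro ⟨r, hr, _, ⟨o, ho, rfl⟩, rfl⟩
    have hn : ‖r • (o : E3)‖ = r := by
      rw [norm_smul, mem_sphere_zero_iff_norm.1 o.2, mul_one, Real.norm_of_nonneg hr.1.le]
    rw [hn, inner_smul_right, mul_div_cancel_left₀ _ hr.1.ne']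
    exact ⟨pow_pos hr.1 2, pow_lt_one₀ hr.1.le hr.2 two_ne_zero, ho⟩
  · rintro ⟨h0, h1, hA⟩
    have hx : 0 < ‖x‖ := by
      rcases (norm_nonneg x).eq_or_lt with h | h
      · simp [← h] at h0
      · exact h
    refine ⟨‖x‖, ⟨hx, by nlinarith⟩, ‖x‖⁻¹ • x, ⟨⟨‖x‖⁻¹ • x, ?_⟩, ?_, rfl⟩, ?_⟩
    · rw [mem_sphere_zero_iff_norm, norm_smul, norm_inv, norm_norm, inv_mul_cancel₀ hx.ne']
    · simpa [inner_smul_right, div_eq_inv_mul] using hA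
    · rw [smul_smul, mul_inv_cancel₀ hx.ne', one_smul]

instance : IsProbabilityMeasure uniformSphere where
  measure_univ := by
    rw [uniformSphere, Measure.smul_apply, smul_eq_mul]
    exact ENNReal.inv_mul_cancel
      (by rw [Ne, Measure.measure_univ_eq_zero]; exact Measure.toSphere_ne_zero _)
      (measure_ne_top _ _)

/-- Archimedes' hat-box theorem: each coordinate of a uniform random unit vector is uniform. -/
theorem map_inner_uniformSphere (v : S2) :
    uniformSphere.map (fun o : S2 => inner ℝ (v : E3) (o : E3)) =
      (2⁻¹ : ℝ≥0∞) • volume.restrict (Ioo (-1 : ℝ) 1) := by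
  have hm : Measurable fun o : S2 => inner ℝ (v : E3) (o : E3) := by fun_prop
  -- Proportionality suffices: total mass one then forces `c = 2⁻¹`, with no need to evaluate the
  -- sphere's area or the radial integral.
  obtain ⟨c, hc⟩ : ∃ c : ℝ≥0∞, uniformSphere.map (fun o : S2 => inner ℝ (v : E3) (o : E3)) =
      c • volume.restrict (Ioo (-1 : ℝ) 1) := by
    refine ⟨((volume : Measure E3).toSphere univ)⁻¹ * (Module.finrank ℝ E3 *
      (ENNReal.ofReal Real.pi * ∫⁻ ρ in Ioi (0 : ℝ), ENNReal.ofReal √ρ *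
        (Iio (1 : ℝ)).indicator 1 ρ)), ?_⟩
    ext A hA
    set F : ℝ → ℝ → ℝ≥0∞ := fun z ρ =>
      {p : ℝ × ℝ | 0 < p.2 ∧ p.2 < 1 ∧ p.1 / √p.2 ∈ A}.indicator 1 (z, ρ) with hF
    have hS : MeasurableSet {p : ℝ × ℝ | 0 < p.2 ∧ p.2 < 1 ∧ p.1 / √p.2 ∈ A} :=
      (measurableSet_lt measurable_const measurable_snd).inter
        ((measurableSet_lt measurable_snd measurable_const).inter
          (hA.preimage (by fun_prop : Measurable fun p : ℝ × ℝ => p.1 / √p.2)))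
    have hFm : Measurable (Function.uncurry F) := measurable_one.indicator hS
    have hcone : volume {x : E3 | 0 < ‖x‖ ^ 2 ∧ ‖x‖ ^ 2 < 1 ∧
        inner ℝ (v : E3) x / √(‖x‖ ^ 2) ∈ A} =
        ∫⁻ x : E3, F (inner ℝ (v : E3) x) (‖x‖ ^ 2) := by
      exact (lintegral_indicator_one (hS.preimage
        (by fun_prop : Measurable fun x : E3 => (inner ℝ (v : E3) x, ‖x‖ ^ 2)))).symm
    rw [Measure.map_apply hm hA, uniformSphere, Measure.smul_apply, Measure.smul_apply,
      Measure.toSphere_apply' _ (hm hA), cone_preimage_inner, hcone,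
      lintegral_inner_normSq v F hFm, lintegral_radial_slices F hFm]
    simp only [smul_eq_mul, mul_assoc]
    congr 3
    rw [← lintegral_mul_const _ (by
      have : Measurable ((Iio (1 : ℝ)).indicator (1 : ℝ → ℝ≥0∞)) :=
        measurable_one.indicator measurableSet_Iio
      fun_prop)]
    refine setLIntegral_congr_fun measurableSet_Ioi fun ρ hρ => ?_
    have hs : 0 < √ρ := Real.sqrt_pos.2 hρ
    have hρ' : 0 < ρ := hρ
    simp only [mul_assoc]
    congr 1
    by_cases h1 : ρ < 1
    · have : ∀ u, F (√ρ * u) ρ = A.indicator 1 u := by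
        intro u
        have hmem : (√ρ * u, ρ) ∈ {p : ℝ × ℝ | 0 < p.2 ∧ p.2 < 1 ∧ p.1 / √p.2 ∈ A} ↔ u ∈ A := by
          simp [h1, hρ', mul_div_cancel_left₀ _ hs.ne']
        by_cases hu : u ∈ A
        · exact (indicator_of_mem (hmem.2 hu) _).trans (indicator_of_mem hu (1 : ℝ → ℝ≥0∞)).symm
        · exact (indicator_of_notMem (mt hmem.1 hu) _).trans (indicator_of_notMem hu _).symm
      simp [this, lintegral_indicator_one hA, h1]
    · simp [hF, h1]
  have hp : (uniformSphere.map fun o : S2 => inner ℝ (v : E3) (o : E3)) univ = 1 := by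
    rw [Measure.map_apply hm MeasurableSet.univ, preimage_univ, measure_univ]
  rw [hc, Measure.smul_apply, Measure.restrict_apply_univ, Real.volume_Ioo, smul_eq_mul] at hp
  have : c = 2⁻¹ := by
    apply ENNReal.eq_inv_of_mul_eq_one_left
    rw [← hp]
    norm_num
  rw [hc, this]

/-! ### Fields and magnitudes in terms of `⟨d, o⟩` -/

theorem inner_eq_sum (d o : S2) :
    inner ℝ (d : E3) (o : E3) = (d : E3) 0 * (o : E3) 0 + (d : E3) 1 * (o : E3) 1 +
      (d : E3) 2 * (o : E3) 2 := by
  simp [PiLp.inner_apply, Fin.sum_univ_three, mul_comm]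

theorem bNear_eq (d o : S2) :
    bNear d o = (3 / 2 * inner ℝ (d : E3) (o : E3)) • (d : E3) - (1 / 2 : ℝ) • (o : E3) := by
  ext i
  rw [inner_eq_sum]
  fin_cases i <;>
  · simp [bNear, outer, Matrix.toLpLin_apply, Matrix.mulVec, dotProduct, Fin.sum_univ_three,
      Matrix.vecMulVec_apply]
    ring

theorem bFar_eq (d o : S2) :
    bFar d o = (o : E3) - inner ℝ (d : E3) (o : E3) • (d : E3) := by
  ext i
  rw [inner_eq_sum]
  fin_cases i <;>
  · simp [bFar, outer, Matrix.toLpLin_apply, Matrix.mulVec, dotProduct, Fin.sum_univ_three,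
      Matrix.vecMulVec_apply]
    ring

theorem betaNear_eq (d o : S2) :
    betaNear d o = √((1 + 3 * inner ℝ (d : E3) (o : E3) ^ 2) / 4) := by
  have hd : ‖(d : E3)‖ = 1 := mem_sphere_zero_iff_norm.1 d.2
  have ho : ‖(o : E3)‖ = 1 := mem_sphere_zero_iff_norm.1 o.2
  rw [betaNear, ← Real.sqrt_sq (norm_nonneg (bNear d o)), bNear_eq, norm_sub_sq_real, norm_smul,
    norm_smul, hd, ho, inner_smul_left, inner_smul_right, mul_one, mul_one, Real.norm_eq_abs,
    Real.norm_eq_abs, sq_abs, sq_abs]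
  congr 1
  simp only [conj_trivial]
  ring

theorem betaFar_eq (d o : S2) :
    betaFar d o = √(1 - inner ℝ (d : E3) (o : E3) ^ 2) := by
  have hd : ‖(d : E3)‖ = 1 := mem_sphere_zero_iff_norm.1 d.2
  have ho : ‖(o : E3)‖ = 1 := mem_sphere_zero_iff_norm.1 o.2
  rw [betaFar, ← Real.sqrt_sq (norm_nonneg (bFar d o)), bFar_eq, norm_sub_sq_real, norm_smul,
    hd, ho, inner_smul_right, real_inner_comm, mul_one, Real.norm_eq_abs, sq_abs]
  congr 1
  ring

theorem measurable_bNear (d : S2) : Measurable (bNear d) :=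
  ((LinearMap.continuous_of_finiteDimensional _).comp continuous_subtype_val).measurable

theorem measurable_bFar (d : S2) : Measurable (bFar d) :=
  ((LinearMap.continuous_of_finiteDimensional _).comp continuous_subtype_val).measurable

theorem lintegral_even (k : ℝ → ℝ≥0∞) (hk : ∀ u, k (-u) = k u) :
    ∫⁻ u in Ioo (-1) 1, k u = 2 * ∫⁻ u in Ioo 0 1, k u := by
  have hneg : ∫⁻ u in Ioo (-1) 0, k u = ∫⁻ u in Ioo 0 1, k u := by
    rw [← (Measure.measurePreserving_neg (volume : Measure ℝ)).setLIntegral_comp_preimage_emb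
      (MeasurableEquiv.neg ℝ).measurableEmbedding k (Ioo 0 1)]
    simp [hk]
  rw [← Ioo_union_Ico_eq_Ioo (b := (0 : ℝ)) (by norm_num) (by norm_num),
    lintegral_union measurableSet_Ico
      (disjoint_left.2 fun u h1 h2 => absurd h1.2 (not_lt.2 h2.1)), hneg,
    setLIntegral_congr (Ioo_ae_eq_Ico (a := (0 : ℝ)) (b := 1)).symm, two_mul]

/-! ### Densities of functions of a uniform variable and of random projections -/

section Density

variable {Ω : Type*} [MeasurableSpace Ω] {P : Measure Ω} {X : Ω → ℝ} {f : ℝ → ℝ}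

theorem HasDensity.lintegral_comp (h : HasDensity X f P) (g : ℝ → ℝ≥0∞) (hg : Measurable g) :
    ∫⁻ ω, g (X ω) ∂P = ∫⁻ x, ENNReal.ofReal (f x) * g x := by
  rw [h.hasLaw.lintegral_comp hg.aemeasurable,
    lintegral_withDensity_eq_lintegral_mul _ h.measurable.ennreal_ofReal hg]
  rfl

theorem hasDensity_of_lintegral (hX : AEMeasurable X P) (hf : Measurable f) (hf0 : ∀ x, 0 ≤ f x)
    (h : ∀ g : ℝ → ℝ≥0∞, Measurable g →
      ∫⁻ ω, g (X ω) ∂P = ∫⁻ x, ENNReal.ofReal (f x) * g x) : HasDensity X f P where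
  measurable := hf
  nonneg := hf0
  hasLaw :=
    { aemeasurable := hX
      map_eq := by
        refine Measure.ext_of_lintegral _ fun g hg => ?_
        rw [lintegral_map' hg.aemeasurable hX, h g hg,
          lintegral_withDensity_eq_lintegral_mul _ hf.ennreal_ofReal hg]
        rfl }

/-- Change of variables for an even function `φ` of a variable uniform on `(-1, 1)`, with `ψ`
inverse to `φ` on `(0, 1)`. -/
theorem hasDensity_comp_of_uniform {T : Ω → ℝ}
    (hT : HasLaw T ((2⁻¹ : ℝ≥0∞) • volume.restrict (Ioo (-1 : ℝ) 1)) P)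
    {φ ψ ψ' : ℝ → ℝ} {a b : ℝ} (hφ : Measurable φ) (heven : ∀ t, φ (-t) = φ t)
    (hmaps : ∀ t ∈ Ioo (0 : ℝ) 1, φ t ∈ Ioo a b ∧ ψ (φ t) = t)
    (hinv : ∀ y ∈ Ioo a b, ψ y ∈ Ioo (0 : ℝ) 1 ∧ φ (ψ y) = y)
    (hψ : ∀ y ∈ Ioo a b, HasDerivAt ψ (ψ' y) y)
    (hf : Measurable f) (hf0 : ∀ x, 0 ≤ f x) (hfψ : ∀ y ∈ Ioo a b, f y = |ψ' y|)
    (hfz : ∀ y ∉ Icc a b, f y = 0) :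
    HasDensity (fun ω => φ (T ω)) f P := by
  refine hasDensity_of_lintegral (hφ.comp_aemeasurable hT.aemeasurable) hf hf0 fun g hg => ?_
  have himage : ψ '' Ioo a b = Ioo 0 1 := by
    ext t
    constructor
    · rintro ⟨y, hy, rfl⟩
      exact (hinv y hy).1
    · intro ht
      exact ⟨φ t, hmaps t ht⟩
  have hinj : InjOn ψ (Ioo a b) := fun x hx y hy hxy => by
    rw [← (hinv x hx).2, ← (hinv y hy).2, hxy]
  rw [hT.lintegral_comp (f := fun t => g (φ t)) (hg.comp hφ).aemeasurable, lintegral_smul_measure,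
    lintegral_even _ (fun u => by rw [heven]), smul_eq_mul, ← mul_assoc,
    ENNReal.inv_mul_cancel two_ne_zero ofNat_ne_top, one_mul, ← himage,
    lintegral_image_eq_lintegral_abs_deriv_mul measurableSet_Ioo
      (fun y hy => (hψ y hy).hasDerivWithinAt) hinj]
  have hIcc : ∫⁻ x, ENNReal.ofReal (f x) * g x = ∫⁻ x in Icc a b, ENNReal.ofReal (f x) * g x := by
    rw [← lintegral_indicator measurableSet_Icc]
    refine lintegral_congr fun x => ?_
    by_cases hx : x ∈ Icc a b
    · rw [indicator_of_mem hx]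
    · rw [indicator_of_notMem hx, hfz x hx, ENNReal.ofReal_zero, zero_mul]
  -- Endpoints are null, so the values of `pdfBetaNear` at `1/2` and `pdfBetaFar` at `1`, where
  -- division by zero occurs, are harmless.
  rw [hIcc, ← setLIntegral_congr Ioo_ae_eq_Icc]
  refine setLIntegral_congr_fun measurableSet_Ioo fun y hy => ?_
  simp only [(hinv y hy).2, hfψ y hy]

/-- The density of the projection of a random vector `b oTx` onto an independent uniform
direction, in terms of the density of its length. -/
theorem hasDensity_inner [IsProbabilityMeasure P] {oTx oRx : Ω → S2}
    (hTx : HasLaw oTx uniformSphere P) (hRx : HasLaw oRx uniformSphere P)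
    (hindep : IndepFun oTx oRx P) {b : S2 → E3} (hb : Measurable b)
    (hβ : HasDensity (fun ω => ‖b (oTx ω)‖) f P) (hf : ∀ y ≤ 0, f y = 0)
    {h : ℝ → ℝ} (hh : Measurable h) (hh0 : ∀ x, 0 ≤ h x)
    (hfh : ∀ x, ∫⁻ y in Ioi |x|, ENNReal.ofReal (f y / (2 * y)) = ENNReal.ofReal (h x)) :
    HasDensity (fun ω => inner ℝ (oRx ω : E3) (b (oTx ω))) h P := by
  have hprod := (indepFun_iff_hasLaw_prodMk_prod hTx hRx).1 hindep
  have hJ : Measurable fun p : S2 × S2 => inner ℝ (p.2 : E3) (b p.1) := by fun_prop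
  refine hasDensity_of_lintegral (hJ.comp_aemeasurable hprod.aemeasurable) hh hh0 fun g hg => ?_
  -- `K y` is the expectation of `g (y * U)` for `U` uniform on `(-1, 1)`.
  set K : ℝ → ℝ≥0∞ := fun y => 2⁻¹ * ∫⁻ u in Ioo (-1) 1, g (y * u)
  have hKm : Measurable K := by
    refine Measurable.const_mul ?_ _
    exact Measurable.lintegral_prod_right (f := fun y u => g (y * u))
      (by fun_prop : Measurable fun p : ℝ × ℝ => g (p.1 * p.2))
  have hinner (o : S2) : ∫⁻ o' : S2, g (inner ℝ (o' : E3) (b o)) ∂uniformSphere = K ‖b o‖ := by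
    -- If `b o = 0`, any unit vector serves; `o` is at hand.
    obtain ⟨v, hv⟩ : ∃ v : S2, b o = ‖b o‖ • (v : E3) := by
      by_cases h0 : b o = 0
      · exact ⟨o, by simp [h0]⟩
      · refine ⟨⟨‖b o‖⁻¹ • b o, ?_⟩, ?_⟩
        · rw [mem_sphere_zero_iff_norm, norm_smul, norm_inv, norm_norm,
            inv_mul_cancel₀ (norm_ne_zero_iff.2 h0)]
        · rw [smul_smul, mul_inv_cancel₀ (norm_ne_zero_iff.2 h0), one_smul]
    have e (o' : S2) : inner ℝ (o' : E3) (b o) = ‖b o‖ * inner ℝ (v : E3) (o' : E3) := by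
      conv_lhs => rw [hv]
      rw [inner_smul_right, real_inner_comm]
    have hgm : Measurable fun t => g (‖b o‖ * t) := by fun_prop
    simp only [e]
    rw [← lintegral_map hgm (by fun_prop : Measurable fun o' : S2 => inner ℝ (v : E3) (o' : E3)),
      map_inner_uniformSphere, lintegral_smul_measure, smul_eq_mul]
  have hKy (y : ℝ) (hy : 0 < y) : ENNReal.ofReal (f y) * K y =
      ENNReal.ofReal (f y / (2 * y)) * ∫⁻ x, (Ioo (-y) y).indicator g x := by
    rw [← lintegral_comp_mul_left hy _ (hg.indicator measurableSet_Ioo),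
      ← mul_assoc (ENNReal.ofReal (f y / (2 * y))),
      ← ENNReal.ofReal_mul (div_nonneg (hβ.nonneg y) (by positivity)), show K y = 2⁻¹ * ∫⁻ u in Ioo (-1) 1, g (y * u) from rfl,
      ← lintegral_indicator measurableSet_Ioo, ← mul_assoc]
    congr 1
    · rw [show f y / (2 * y) * y = f y * 2⁻¹ by field_simp, ENNReal.ofReal_mul (hβ.nonneg y),
        ENNReal.ofReal_inv_of_pos two_pos, ENNReal.ofReal_ofNat]
    · refine lintegral_congr fun u => ?_
      have : y * u ∈ Ioo (-y) y ↔ u ∈ Ioo (-1) 1 := by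
        rw [mem_Ioo, mem_Ioo, ← abs_lt, ← abs_lt, abs_mul, abs_of_pos hy,
          mul_lt_iff_lt_one_right hy]
      simp only [indicator_apply, this]
  -- After `x = y * u`, the domain is `|x| < y`; Tonelli on `W` turns it into the tail integral over
  -- `y > |x|`.
  set W : ℝ → ℝ → ℝ≥0∞ := fun y x =>
    {p : ℝ × ℝ | |p.2| < p.1}.indicator
      (fun p => ENNReal.ofReal (f p.1 / (2 * p.1)) * g p.2) (y, x) with hW
  have hfm := hβ.measurable
  have hWm : Measurable fun p : ℝ × ℝ => W p.1 p.2 :=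
    Measurable.indicator (by fun_prop) (measurableSet_lt (by fun_prop) (by fun_prop))
  calc ∫⁻ ω, g (inner ℝ (oRx ω : E3) (b (oTx ω))) ∂P
      = ∫⁻ p : S2 × S2, g (inner ℝ (p.2 : E3) (b p.1)) ∂(uniformSphere.prod uniformSphere) :=
        hprod.lintegral_comp (f := fun p : S2 × S2 => g (inner ℝ (p.2 : E3) (b p.1)))
          (hg.comp hJ).aemeasurable
    _ = ∫⁻ o, K ‖b o‖ ∂uniformSphere := by
        rw [lintegral_prod (fun p : S2 × S2 => g (inner ℝ (p.2 : E3) (b p.1)))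
          (hg.comp hJ).aemeasurable]
        exact lintegral_congr hinner
    _ = ∫⁻ ω, K ‖b (oTx ω)‖ ∂P :=
        (hTx.lintegral_comp (f := fun o => K ‖b o‖) (by fun_prop)).symm
    _ = ∫⁻ y, ENNReal.ofReal (f y) * K y := hβ.lintegral_comp K hKm
    _ = ∫⁻ y, ∫⁻ x, W y x := by
        refine lintegral_congr fun y => ?_
        rcases le_or_gt y 0 with hy | hy
        · rw [hf y hy, ENNReal.ofReal_zero, zero_mul, ← lintegral_zero]
          refine lintegral_congr fun x => ?_
          exact (indicator_of_notMem (s := {p : ℝ × ℝ | |p.2| < p.1}) (a := (y, x))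
            (not_lt.2 (hy.trans (abs_nonneg x))) _).symm
        · rw [hKy y hy, ← lintegral_const_mul _ (hg.indicator measurableSet_Ioo)]
          refine lintegral_congr fun x => ?_
          simp only [hW, indicator_apply, mem_Ioo, ← abs_lt, mem_ofPred_eq, mul_ite, mul_zero]
    _ = ∫⁻ x, ∫⁻ y, W y x := lintegral_lintegral_swap hWm.aemeasurable
    _ = ∫⁻ x, ENNReal.ofReal (h x) * g x := by
        refine lintegral_congr fun x => ?_
        rw [← hfh x, ← lintegral_indicator measurableSet_Ioi,
          ← lintegral_mul_const _ (Measurable.indicator (by fun_prop) measurableSet_Ioi)]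
        refine lintegral_congr fun y => ?_
        simp only [hW, indicator_apply, mem_Ioi, mem_ofPred_eq, ite_mul, zero_mul]

end Density

/-! ### The explicit densities -/

/-- Nonnegativity gives integrability of `G'` even if it blows up at an endpoint, as for `arcosh
(2y)` at `1/2` and `arcsin` at `1`. -/
theorem lintegral_deriv_of_nonneg {G G' : ℝ → ℝ} {a b : ℝ} (hab : a ≤ b)
    (hcont : ContinuousOn G (Icc a b)) (hderiv : ∀ x ∈ Ioo a b, HasDerivAt G (G' x) x)
    (hpos : ∀ x ∈ Ioo a b, 0 ≤ G' x) :
    ∫⁻ x in Ioo a b, ENNReal.ofReal (G' x) = ENNReal.ofReal (G b - G a) := by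
  have hint : IntegrableOn G' (Ioc a b) :=
    intervalIntegral.integrableOn_deriv_of_nonneg hcont hderiv hpos
  have hint' : IntegrableOn G' (Ioo a b) := hint.mono_set Ioo_subset_Ioc_self
  rw [← intervalIntegral.integral_eq_sub_of_hasDerivAt_of_le hab hcont hderiv
    ((intervalIntegrable_iff_integrableOn_Ioc_of_le hab).2 hint),
    intervalIntegral.integral_of_le hab, integral_Ioc_eq_integral_Ioo,
    ofReal_integral_eq_lintegral_ofReal hint'
      ((ae_restrict_iff' measurableSet_Ioo).2 (Filter.Eventually.of_forall hpos))]

theorem measurable_pdfJNear : Measurable pdfJNear := by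
  unfold pdfJNear Real.arcosh
  refine Measurable.const_mul (Measurable.ite (measurableSet_le (by fun_prop) (by fun_prop))
    (by fun_prop) (Measurable.ite (measurableSet_lt (by fun_prop) (by fun_prop))
    (by fun_prop) (by fun_prop))) _

theorem measurable_pdfJFar : Measurable pdfJFar :=
  Measurable.indicator (by fun_prop) measurableSet_Icc

theorem measurable_pdfBetaNear : Measurable pdfBetaNear :=
  Measurable.indicator (by fun_prop) measurableSet_Icc

theorem measurable_pdfBetaFar : Measurable pdfBetaFar :=
  Measurable.indicator (by fun_prop) measurableSet_Icc

theorem pdfJNear_nonneg (x : ℝ) : 0 ≤ pdfJNear x := by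
  have h2 : 0 < Real.arcosh 2 := Real.arcosh_pos (by norm_num)
  unfold pdfJNear betaBar
  refine mul_nonneg (by positivity) ?_
  split_ifs with h h'
  · exact zero_le_one
  · rw [sub_nonneg, div_le_one h2, Real.arcosh_le_arcosh (by linarith) two_pos]
    linarith
  · exact le_rfl

theorem pdfJFar_nonneg (x : ℝ) : 0 ≤ pdfJFar x :=
  indicator_nonneg (fun y _ => mul_nonneg (by norm_num)
    (sub_nonneg.2 (Real.arcsin_le_pi_div_two _))) x

theorem pdfBetaNear_nonneg (x : ℝ) : 0 ≤ pdfBetaNear x := by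
  refine indicator_nonneg (fun y hy => ?_) x
  have : 0 ≤ y := by linarith [hy.1]
  positivity

theorem pdfBetaFar_nonneg (x : ℝ) : 0 ≤ pdfBetaFar x := by
  refine indicator_nonneg (fun y hy => ?_) x
  have : 0 ≤ y := hy.1
  positivity

section Magnitudes

variable {Ω : Type*} [MeasurableSpace Ω] {P : Measure Ω} {T : Ω → ℝ}

theorem hasDensity_pdfBetaNear
    (hT : HasLaw T ((2⁻¹ : ℝ≥0∞) • volume.restrict (Ioo (-1 : ℝ) 1)) P) :
    HasDensity (fun ω => √((1 + 3 * T ω ^ 2) / 4)) pdfBetaNear P := by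
  refine hasDensity_comp_of_uniform hT (φ := fun t => √((1 + 3 * t ^ 2) / 4))
    (ψ := fun y => √((4 * y ^ 2 - 1) / 3))
    (ψ' := fun y => (4 * (2 * y) / 3) / (2 * √((4 * y ^ 2 - 1) / 3)))
    (a := 1 / 2) (b := 1) (by fun_prop) (fun t => by rw [neg_sq]) ?_ ?_ ?_
    measurable_pdfBetaNear pdfBetaNear_nonneg ?_ fun y hy => indicator_of_notMem hy _
  · rintro t ⟨h0, h1⟩
    refine ⟨⟨Real.lt_sqrt_of_sq_lt (by nlinarith), ?_⟩, ?_⟩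
    · rw [Real.sqrt_lt' one_pos]
      nlinarith
    · rw [Real.sq_sqrt (by positivity),
        show (4 * ((1 + 3 * t ^ 2) / 4) - 1) / 3 = t ^ 2 by ring, Real.sqrt_sq h0.le]
  · rintro y ⟨h0, h1⟩
    have hy : 0 < (4 * y ^ 2 - 1) / 3 := by nlinarith
    refine ⟨⟨Real.sqrt_pos.2 hy, ?_⟩, ?_⟩
    · rw [Real.sqrt_lt' one_pos]
      nlinarith
    · rw [Real.sq_sqrt hy.le,
        show (1 + 3 * ((4 * y ^ 2 - 1) / 3)) / 4 = y ^ 2 by ring, Real.sqrt_sq (by linarith)]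
  · rintro y ⟨h0, h1⟩
    have hy : 0 < (4 * y ^ 2 - 1) / 3 := by nlinarith
    refine HasDerivAt.sqrt ?_ hy.ne'
    simpa using (((hasDerivAt_pow 2 y).const_mul 4).sub_const 1).div_const 3
  · rintro y ⟨h0, h1⟩
    have hy : 0 < 4 * y ^ 2 - 1 := by nlinarith
    have hs := Real.sqrt_pos.2 hy
    have h3 : 0 < √(3 : ℝ) := by positivity
    have hy0 : 0 < y := by linarith
    rw [pdfBetaNear, indicator_of_mem (mem_Icc.2 ⟨h0.le, h1.le⟩), abs_of_nonneg (by positivity),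
      Real.sqrt_div hy.le]
    field_simp
    linear_combination - Real.sq_sqrt (show (0 : ℝ) ≤ 3 by norm_num)

theorem hasDensity_pdfBetaFar
    (hT : HasLaw T ((2⁻¹ : ℝ≥0∞) • volume.restrict (Ioo (-1 : ℝ) 1)) P) :
    HasDensity (fun ω => √(1 - T ω ^ 2)) pdfBetaFar P := by
  -- `t ↦ √(1 - t²)` is an involution of `(0, 1)`, so this one fact serves for both `hmaps` and
  -- `hinv`.
  have hinv : ∀ y ∈ Ioo (0 : ℝ) 1, √(1 - y ^ 2) ∈ Ioo (0 : ℝ) 1 ∧ √(1 - √(1 - y ^ 2) ^ 2) = y := by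
    rintro y ⟨h0, h1⟩
    have hy : 0 < 1 - y ^ 2 := by nlinarith
    refine ⟨⟨Real.sqrt_pos.2 hy, ?_⟩, ?_⟩
    · rw [Real.sqrt_lt' one_pos]
      nlinarith
    · rw [Real.sq_sqrt hy.le, _root_.sub_sub_cancel, Real.sqrt_sq h0.le]
  refine hasDensity_comp_of_uniform hT (φ := fun t => √(1 - t ^ 2))
    (ψ := fun y => √(1 - y ^ 2)) (ψ' := fun y => (-(2 * y)) / (2 * √(1 - y ^ 2)))
    (a := 0) (b := 1) (by fun_prop) (fun t => by rw [neg_sq]) hinv hinv ?_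
    measurable_pdfBetaFar pdfBetaFar_nonneg ?_ fun y hy => indicator_of_notMem hy _
  · rintro y ⟨h0, h1⟩
    have hy : 0 < 1 - y ^ 2 := by nlinarith
    refine HasDerivAt.sqrt ?_ hy.ne'
    simpa using (hasDerivAt_pow 2 y).const_sub 1
  · rintro y ⟨h0, h1⟩
    rw [pdfBetaFar, indicator_of_mem (mem_Icc.2 ⟨h0.le, h1.le⟩), neg_div, abs_neg,
      mul_div_mul_left _ _ two_ne_zero, abs_of_nonneg (by positivity)]

end Magnitudes

/-! ### Tail integrals giving the alignment densities -/

theorem setLIntegral_Ioi_of_support {G : ℝ → ℝ≥0∞} {a b m : ℝ} {f : ℝ → ℝ}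
    (hG : ∀ y ∈ Ioo m b, ENNReal.ofReal (f y / (2 * y)) = G y) (hf : ∀ y ∉ Icc a b, f y = 0)
    {x : ℝ} (hm : m = max a x) :
    ∫⁻ y in Ioi x, ENNReal.ofReal (f y / (2 * y)) = ∫⁻ y in Ioo m b, G y := by
  rw [← setLIntegral_congr_fun measurableSet_Ioo hG, ← lintegral_indicator measurableSet_Ioi,
    ← lintegral_indicator measurableSet_Ioo]
  refine lintegral_congr_ae ?_
  filter_upwards [compl_mem_ae_iff.2 (measure_singleton (μ := volume) a),
    compl_mem_ae_iff.2 (measure_singleton (μ := volume) b)] with y hya hyb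
  by_cases hy : y ∈ Icc a b
  · have h1 : a < y := lt_of_le_of_ne hy.1 (Ne.symm hya)
    have h2 : y < b := lt_of_le_of_ne hy.2 hyb
    simp [indicator_apply, hm, h1, h2]
  · simp [indicator_apply, hf y hy]

/-- The integrand is the derivative of `arcosh (2y) / √3`. The lower limit `max (1/2) |x|` produces
the plateau on `|x| ≤ 1/2`, where `arcosh 1 = 0`. -/
theorem lintegral_pdfBetaNear (x : ℝ) :
    ∫⁻ y in Ioi |x|, ENNReal.ofReal (pdfBetaNear y / (2 * y)) = ENNReal.ofReal (pdfJNear x) := by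
  have h2 : 0 < Real.arcosh 2 := Real.arcosh_pos (by norm_num)
  have h3 : 0 < √(3 : ℝ) := by positivity
  have hm : (1 / 2 : ℝ) ≤ max (1 / 2) |x| := le_max_left _ _
  rw [setLIntegral_Ioi_of_support (f := pdfBetaNear) (a := 1 / 2) (b := 1)
    (m := max (1 / 2) |x|)
    (G := fun y => ENNReal.ofReal ((√((2 * y) ^ 2 - 1))⁻¹ * (2 * 1) / √3))
    ?_ (fun y hy => indicator_of_notMem hy _) rfl]
  · rcases le_or_gt 1 |x| with hx | hx
    · rw [Ioo_eq_empty (not_lt.2 (hx.trans (le_max_right _ _))), Measure.restrict_empty,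
        lintegral_zero_measure, pdfJNear, if_neg (by linarith), if_neg (by linarith), mul_zero,
        ENNReal.ofReal_zero]
    · rw [lintegral_deriv_of_nonneg (G := fun y => Real.arcosh (2 * y) / √3)
        (max_le (by norm_num) hx.le)]
      · congr 1
        rw [pdfJNear, betaBar]
        rcases le_or_gt |x| (1 / 2) with hx' | hx'
        · rw [if_pos hx', max_eq_left hx']
          norm_num
          field_simp
        · rw [if_neg (not_le.2 hx'), if_pos hx, max_eq_right hx'.le]
          field_simp
      · refine ContinuousOn.div_const (Real.continuousOn_arcosh.comp (by fun_prop)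
          fun y hy => ?_) _
        have := hm.trans hy.1
        simp only [mem_Ici]
        linarith
      · intro y hy
        have := hm.trans_lt hy.1
        exact ((Real.hasDerivAt_arcosh (x := 2 * y) (by rw [mem_Ioi]; linarith)).comp y
          ((hasDerivAt_id y).const_mul 2)).div_const _
      · intro y hy
        positivity
  · intro y hy
    have hy' := hm.trans_lt hy.1
    have hy0 : 0 < y := by linarith
    rw [pdfBetaNear, indicator_of_mem (mem_Icc.2 ⟨hy'.le, hy.2.le⟩)]
    congr 1
    rw [mul_pow]
    norm_num
    field_simp
    norm_num

theorem lintegral_pdfBetaFar (x : ℝ) :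
    ∫⁻ y in Ioi |x|, ENNReal.ofReal (pdfBetaFar y / (2 * y)) = ENNReal.ofReal (pdfJFar x) := by
  have hm : (0 : ℝ) ≤ |x| := abs_nonneg x
  rw [setLIntegral_Ioi_of_support (f := pdfBetaFar) (a := 0) (b := 1) (m := |x|)
    (G := fun y => ENNReal.ofReal (1 / √(1 - y ^ 2) / 2))
    ?_ (fun y hy => indicator_of_notMem hy _) (max_eq_right hm).symm]
  · rcases le_or_gt |x| 1 with hx | hx
    · rw [lintegral_deriv_of_nonneg (G := fun y => Real.arcsin y / 2) hx]
      · congr 1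
        rw [pdfJFar, indicator_of_mem (mem_Icc.2 (abs_le.1 hx)), Real.arcsin_one]
        ring
      · exact (Real.continuous_arcsin.div_const _).continuousOn
      · intro y hy
        exact (Real.hasDerivAt_arcsin (by linarith [hy.1]) hy.2.ne).div_const _
      · intro y hy
        positivity
    · rw [Ioo_eq_empty (not_lt.2 hx.le), Measure.restrict_empty, lintegral_zero_measure, pdfJFar,
        indicator_of_notMem (fun h => absurd (abs_le.2 (mem_Icc.1 h)) (not_le.2 hx)), ENNReal.ofReal_zero]
  · intro y hy
    have hy0 := hm.trans_lt hy.1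
    rw [pdfBetaFar, indicator_of_mem (mem_Icc.2 ⟨hy0.le, hy.2.le⟩)]
    congr 1
    field_simp

end DipoleChannel

theorem proposition1 {Ω : Type*} [MeasurableSpace Ω] (P : MeasureTheory.Measure Ω)
    [MeasureTheory.IsProbabilityMeasure P]
    (d : DipoleChannel.S2) (oTx oRx : Ω → DipoleChannel.S2)
    (hTx : ProbabilityTheory.HasLaw oTx DipoleChannel.uniformSphere P)
    (hRx : ProbabilityTheory.HasLaw oRx DipoleChannel.uniformSphere P)
    (hindep : ProbabilityTheory.IndepFun oTx oRx P) :
    DipoleChannel.HasDensity (fun ω => DipoleChannel.JNear d (oTx ω) (oRx ω))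
        DipoleChannel.pdfJNear P ∧
      DipoleChannel.HasDensity (fun ω => DipoleChannel.JFar d (oTx ω) (oRx ω))
        DipoleChannel.pdfJFar P ∧
      DipoleChannel.HasDensity (fun ω => DipoleChannel.betaNear d (oTx ω))
        DipoleChannel.pdfBetaNear P ∧
      DipoleChannel.HasDensity (fun ω => DipoleChannel.betaFar d (oTx ω))
        DipoleChannel.pdfBetaFar P := by
  open DipoleChannel in
  have hT : HasLaw (fun ω => inner ℝ (d : E3) (oTx ω : E3))
      ((2⁻¹ : ENNReal) • volume.restrict (Set.Ioo (-1 : ℝ) 1)) P :=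
    HasLaw.fun_comp (Y := fun o : S2 => inner ℝ (d : E3) (o : E3))
      ⟨by fun_prop, map_inner_uniformSphere d⟩ hTx
  have hnear : HasDensity (fun ω => betaNear d (oTx ω)) pdfBetaNear P := by
    simp only [betaNear_eq]
    exact hasDensity_pdfBetaNear hT
  have hfar : HasDensity (fun ω => betaFar d (oTx ω)) pdfBetaFar P := by
    simp only [betaFar_eq]
    exact hasDensity_pdfBetaFar hT
  refine ⟨?_, ?_, hnear, hfar⟩
  · exact hasDensity_inner hTx hRx hindep (measurable_bNear d) hnear
      (fun y hy => Set.indicator_of_notMem (fun h => by linarith [h.1]) _)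
      measurable_pdfJNear pdfJNear_nonneg lintegral_pdfBetaNear
  · refine hasDensity_inner hTx hRx hindep (measurable_bFar d) hfar (fun y hy => ?_)
      measurable_pdfJFar pdfJFar_nonneg lintegral_pdfBetaFar
    -- Unlike the near case, `y = 0` lies in the indicator's interval, but the numerator vanishes
    -- there.
    refine Set.indicator_apply_eq_zero.2 fun h => ?_
    rw [le_antisymm hy h.1, zero_div]
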